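/- **Conventions.** Languages consist of function symbols of finite arity (constants are allowed), and algebras are nonempty. A *quasivariety* $\mathsf K$, with language $\mathscr L_{\mathsf K}$, is a class of similar algebras closed under isomorphic copies, subalgebras, direct products (including the empty one) and ultraproducts; it is viewed as a category whose arrows are all homomorphisms. A quasivariety $\mathsf M$ is an *expansion* of a quasivariety $\mathsf K$ when $\mathscr L_{\mathsf K}\subseteq\mathscr L_{\mathsf M}$ and the reduct $\mathbf A{\upharpoonright}_{\mathscr L_{\mathsf K}}$ is in $\mathsf K$ for every $\mathbf A\in\mathsf M$; $U\colon\mathsf M\to\mathsf K$ is then the forgetful functor. It has a left adjoint, the *free extension functor* $F\colon\mathsf K\to\mathsf M$, $F(\mathbf A)=\boldsymbol T_{\mathsf M}(A)/\theta_{\mathbf A}$, where $\boldsymbol T_{\mathsf M}(A)$ is the free algebra of $\mathsf M$ over the set $A$ and $\theta_{\mathbf A}$ is its least congruence with quotient in $\mathsf M$ that contains all pairs $\langle t(a_1,\dots,a_n),s(a_1,\dots,a_n)\rangle$ with $a_i\in A$, $t,s$ terms of $\mathscr L_{\mathsf K}$ and $t^{\mathbf A}(a_1,\dots,a_n)=s^{\mathbf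 A}(a_1,\dots,a_n)$. The unit is $a\mapsto a/\theta_{\mathbf A}$ and the counit is $t(b_1,\dots,b_n)/\theta_{U(\mathbf B)}\mapsto t^{\mathbf B}(b_1,\dots,b_n)$. For $n\ge 0$, an $n$-ary *operation* of $\mathsf K$ is a family $f=\langle f^{\mathbf A}:\mathbf A\in\mathsf K\rangle$ of partial functions $f^{\mathbf A}\colon \mathrm{dom}(f^{\mathbf A})\to A$, $\mathrm{dom}(f^{\mathbf A})\subseteq A^n$, such that for every homomorphism $h\colon\mathbf A\to\mathbf B$ between members of $\mathsf K$ and every $\bar a\in\mathrm{dom}(f^{\mathbf A})$ we have $h(\bar a)\in\mathrm{dom}(f^{\mathbf B})$ and $h(f^{\mathbf A}(\bar a))=f^{\mathbf B}(h(\bar a))$. A *pp formula* is an existentially quantified finite conjunction of equations. Let $\mathsf{ext}_{pp}(\mathsf K)$ be the class of the operations $f$ of $\mathsf K$ that are * *pp definable*: there is a pp formula $\varphi(x_1,\dots,x_n,y)$ of $\mathscr L_{\mathsf K}$ such that for all $\mathbf A\in\mathsf K$ and $\bar a,b$ in $A$, $\mathbf A\vDash\varphi(\bar a,b)$ iff $\bar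 a\in\mathrm{dom}(f^{\mathbf A})$ and $f^{\mathbf A}(\bar a)=b$; and * *extendable*: for all $\mathbf A\in\mathsf K$ and $\bar a\in A^n$ there is an extension $\mathbf B\in\mathsf K$ of $\mathbf A$ with $\bar a\in\mathrm{dom}(f^{\mathbf B})$. Given a family $\mathcal F=(f_i)_{i\in I}$ of members of $\mathsf{ext}_{pp}(\mathsf K)$ (repetitions allowed), let $\mathscr L_{\mathcal F}$ be $\mathscr L_{\mathsf K}$ with a new function symbol $g_i$, of the arity of $f_i$, added for each $i\in I$. For $\mathbf A\in\mathsf K$ on which all $f_i$ are total, $\mathbf A[\mathscr L_{\mathcal F}]$ is the expansion of $\mathbf A$ that interprets $g_i$ as $f_i^{\mathbf A}$; $\mathsf K[\mathscr L_{\mathcal F}]$ is the class of all these algebras. The *pp expansion* of $\mathsf K$ induced by $\mathcal F$ is the class $\mathbb S(\mathsf K[\mathscr L_{\mathcal F}])$ of subalgebras of members of $\mathsf K[\mathscr L_{\mathcal F}]$. A pp expansion of $\mathsf K$ is *simple* when it is of the form $\mathsf K[\mathscr L_{\mathcal F}]$ for some such family $\mathcal F$. (Classes are compared up to the names of the new symbols.)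 A full subcategory is *mono-reflective* when its inclusion functor has a left adjoint and the components of the unit are monomorphisms. **Theorem.** Let $\mathsf M$ be an expansion of a quasivariety $\mathsf K$. The following conditions are equivalent: 1. $\mathsf M$ is a simple pp expansion of $\mathsf K$; 2. each component of the unit of the adjunction $F\dashv U$ is a monomorphism, and the counit is a natural isomorphism; 3. the direct image $U[\mathsf M]$ is a mono-reflective (in particular full) subcategory of $\mathsf K$, and $U\colon\mathsf M\to U[\mathsf M]$ is an isomorphism of categories. -/

import Mathlib

open CategoryTheory FirstOrder
open FirstOrder.Language (LHom Term Structure)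

universe u v v'

namespace PPExp

/-! ## Algebras, homomorphisms, quasivarieties -/

/-- An algebra in the language `L`: a nonempty set with an interpretation of the symbols of `L`.
It is used for languages without relation symbols only. -/
structure Alg (L : FirstOrder.Language.{u, v}) where
  carrier : Type u
  [str : L.Structure carrier]
  [ne : Nonempty carrier]

instance {L : FirstOrder.Language.{u, v}} : CoeSort (Alg L) (Type u) := ⟨Alg.carrier⟩

attribute [instance] Alg.str Alg.ne

/-- The category of all `L`-algebras and homomorphisms. -/
instance {L : FirstOrder.Language.{u, v}} : Category.{u} (Alg L) where
  Hom A B := A →[L] B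
  id A := FirstOrder.Language.Hom.id L A
  comp f g := g.comp f

/-- A morphism of the category `Alg L`, as a homomorphism. -/
def Alg.asHom {L : FirstOrder.Language.{u, v}} {A B : Alg L} (h : A ⟶ B) : A →[L] B := h

/-- The direct product of a family of algebras. -/
def Alg.pi {L : FirstOrder.Language.{u, v}} {I : Type u} (A : I → Alg L) : Alg L where
  carrier := ∀ i, A i
  str :=
    { funMap := fun f x i => Structure.funMap f (fun j => x j i)
      RelMap := fun r x => ∀ i, Structure.RelMap r (fun j => x j i) }

/-- The ultraproduct of a family of algebras. -/
def Alg.ultraprod {L : FirstOrder.Language.{u, v}} {I : Type u} (U : Ultrafilter I) (A : I → Alg L) :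
    Alg L where
  carrier := (U : Filter I).Product fun i => A i
  ne := ⟨(Quotient.mk _ fun i => Classical.arbitrary (A i))⟩

/-- The nonempty subuniverse `S` of `A` as an algebra. -/
def Alg.sub {L : FirstOrder.Language.{u, v}} (A : Alg L) (S : L.Substructure A) (hS : Nonempty S) :
    Alg L where
  carrier := S

/-- A class of algebras is a quasivariety when it is closed under isomorphic copies, subalgebras,
direct products (the empty one included) and ultraproducts. -/
structure IsQuasivariety {L : FirstOrder.Language.{u, v}} (K : ObjectProperty (Alg L)) : Prop where
  iso : ∀ A B : Alg L, Nonempty (A ≃[L] B) → K A → K B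
  sub : ∀ (A : Alg L) (S : L.Substructure A) (hS : Nonempty S), K A → K (A.sub S hS)
  prod : ∀ (I : Type u) (A : I → Alg L), (∀ i, K (A i)) → K (Alg.pi A)
  ultraprod : ∀ (I : Type u) (U : Ultrafilter I) (A : I → Alg L), (∀ i, K (A i)) →
    K (Alg.ultraprod U A)

/-- The class of all isomorphic copies of subalgebras of members of `K`. -/
def subalgebras {L : FirstOrder.Language.{u, v}} (K : ObjectProperty (Alg L)) : ObjectProperty (Alg L) :=
  fun A => ∃ B : Alg L, K B ∧ Nonempty (A ↪[L] B)

theorem IsQuasivariety.of_injective {L : FirstOrder.Language.{u, v}} [L.IsAlgebraic]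
    {K : ObjectProperty (Alg L)} (hK : IsQuasivariety K) {A B : Alg L} (f : A →[L] B)
    (hf : Function.Injective f) (hB : K B) : K A := by
  let e : A ↪[L] B :=
    { toFun := f, inj' := hf, map_fun' := fun g x => f.map_fun g x,
      map_rel' := fun r => isEmptyElim r }
  have ne : Nonempty e.toHom.range := ⟨e.equivRange (Classical.arbitrary A)⟩
  exact hK.iso (B.sub e.toHom.range ne) A ⟨e.equivRange.symm⟩ (hK.sub B _ ne hB)

/-! ## Expansions and the forgetful functor -/

/-- The reduct of an `L'`-algebra along an inclusion of languages `ι : L →ᴸ L'`. -/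
def Alg.reduct {L : FirstOrder.Language.{u, v}} {L' : FirstOrder.Language.{u, v'}} (ι : L →ᴸ L') (A : Alg L') :
    Alg L where
  carrier := A
  str := ι.reduct A

/-- The forgetful functor between the categories of all algebras. -/
def reductFunctor {L : FirstOrder.Language.{u, v}} {L' : FirstOrder.Language.{u, v'}} [L.IsAlgebraic] (ι : L →ᴸ L') :
    Alg L' ⥤ Alg L where
  obj A := A.reduct ι
  map {A B} h :=
    letI := ι.reduct A
    letI := ι.reduct B
    { toFun := Alg.asHom h
      map_fun' := fun f x => FirstOrder.Language.Hom.map_fun (Alg.asHom h) (ι.onFunction f) x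
      map_rel' := fun r => isEmptyElim r }

/-- `M` is an expansion of `K`: reducts of members of `M` belong to `K`. -/
def IsExpansion {L : FirstOrder.Language.{u, v}} {L' : FirstOrder.Language.{u, v'}} (ι : L →ᴸ L')
    (K : ObjectProperty (Alg L)) (M : ObjectProperty (Alg L')) : Prop :=
  ∀ A : Alg L', M A → K (A.reduct ι)

/-- The forgetful functor `U : M ⥤ K` of an expansion. -/
def forgetful {L : FirstOrder.Language.{u, v}} {L' : FirstOrder.Language.{u, v'}} [L.IsAlgebraic] (ι : L →ᴸ L')
    {K : ObjectProperty (Alg L)} {M : ObjectProperty (Alg L')} (h : IsExpansion ι K M) :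
    M.FullSubcategory ⥤ K.FullSubcategory :=
  K.lift (M.ι ⋙ reductFunctor ι) fun A => h A.obj A.property

/-! ## Congruences, free algebras, the free extension functor -/

/-- Congruences of an algebra. -/
structure Congr {L : FirstOrder.Language.{u, v}} (A : Alg L) extends Setoid A where
  compat : ∀ {n : ℕ} (f : L.Functions n) (x y : Fin n → A),
    (∀ i, toSetoid (x i) (y i)) → toSetoid (Structure.funMap f x) (Structure.funMap f y)

/-- The quotient algebra `A / θ`. -/
noncomputable def Alg.quot {L : FirstOrder.Language.{u, v}} [L.IsAlgebraic] (A : Alg L) (θ : Congr A) :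
    Alg L where
  carrier := Quotient θ.toSetoid
  str :=
    { funMap := fun f x => Quotient.mk _ (Structure.funMap f fun i => (x i).out)
      RelMap := fun r => isEmptyElim r }
  ne := ⟨Quotient.mk _ (Classical.arbitrary A)⟩

/-- The canonical projection `A → A / θ`. -/
noncomputable def Alg.proj {L : FirstOrder.Language.{u, v}} [L.IsAlgebraic] (A : Alg L) (θ : Congr A) :
    A →[L] A.quot θ where
  toFun := Quotient.mk θ.toSetoid
  map_fun' f x := Quotient.sound (θ.compat f _ _ fun i =>
    Setoid.symm' _ (Quotient.exact (Quotient.out_eq (Quotient.mk θ.toSetoid (x i)))))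
  map_rel' r := isEmptyElim r

theorem Alg.proj_surjective {L : FirstOrder.Language.{u, v}} [L.IsAlgebraic] (A : Alg L) (θ : Congr A) :
    Function.Surjective (A.proj θ) := Quotient.mk_surjective

theorem Alg.proj_eq_iff {L : FirstOrder.Language.{u, v}} [L.IsAlgebraic] (A : Alg L) (θ : Congr A)
    {a b : A} : A.proj θ a = A.proj θ b ↔ θ.toSetoid a b := Quotient.eq

/-- A homomorphism that identifies `θ`-congruent elements factors through `A / θ`. -/
noncomputable def Alg.quotLift {L : FirstOrder.Language.{u, v}} [L.IsAlgebraic] {A B : Alg L} (θ : Congr A)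
    (f : A →[L] B) (h : ∀ a b, θ.toSetoid a b → f a = f b) : A.quot θ →[L] B where
  toFun := Quotient.lift f h
  map_fun' g x := by
    obtain ⟨y, rfl⟩ : ∃ y : Fin _ → A, x = A.proj θ ∘ y :=
      ⟨fun i => (A.proj_surjective θ (x i)).choose,
        funext fun i => (A.proj_surjective θ (x i)).choose_spec.symm⟩
    rw [← FirstOrder.Language.Hom.map_fun]
    exact FirstOrder.Language.Hom.map_fun f g y
  map_rel' r := isEmptyElim r

/-- The least congruence `θ` of `A` that contains `X` and satisfies `A / θ ∈ K`, as the
intersection of all of them. -/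
def Cg {L : FirstOrder.Language.{u, v}} [L.IsAlgebraic] (K : ObjectProperty (Alg L)) (A : Alg L)
    (X : Set (A × A)) : Congr A where
  r a b := ∀ θ : Congr A, K (A.quot θ) → (∀ p ∈ X, θ.toSetoid p.1 p.2) → θ.toSetoid a b
  iseqv :=
    { refl := fun a θ _ _ => θ.toSetoid.refl' a
      symm := fun h θ h₁ h₂ => θ.toSetoid.symm' (h θ h₁ h₂)
      trans := fun h k θ h₁ h₂ => θ.toSetoid.trans' (h θ h₁ h₂) (k θ h₁ h₂) }
  compat f x y h θ h₁ h₂ := θ.compat f x y fun i => h i θ h₁ h₂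

theorem Cg_subset {L : FirstOrder.Language.{u, v}} [L.IsAlgebraic] (K : ObjectProperty (Alg L)) (A : Alg L)
    (X : Set (A × A)) (p : A × A) (hp : p ∈ X) : (Cg K A X).toSetoid p.1 p.2 :=
  fun _ _ h => h p hp

/-- `Cg K A X` is itself a `K`-congruence. -/
theorem quot_Cg_mem {L : FirstOrder.Language.{u, v}} [L.IsAlgebraic] {K : ObjectProperty (Alg L)}
    (hK : IsQuasivariety K) (A : Alg L) (X : Set (A × A)) : K (A.quot (Cg K A X)) := by
  let I := { θ : Congr A // K (A.quot θ) ∧ ∀ p ∈ X, θ.toSetoid p.1 p.2 }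
  let P : Alg L := Alg.pi fun θ : I => A.quot θ.1
  let g : A →[L] P :=
    { toFun := fun a θ => A.proj θ.1 a
      map_fun' := fun f x => funext fun θ => FirstOrder.Language.Hom.map_fun (A.proj θ.1) f x
      map_rel' := fun r => isEmptyElim r }
  have hg : ∀ a b, g a = g b ↔ (Cg K A X).toSetoid a b := fun a b =>
    ⟨fun h θ h₁ h₂ => (A.proj_eq_iff θ).1 (congrFun h (⟨θ, h₁, h₂⟩ : I)),
      fun h => funext fun θ => (A.proj_eq_iff θ.1).2 (h θ.1 θ.2.1 θ.2.2)⟩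
  refine hK.of_injective (Alg.quotLift (Cg K A X) g fun a b h => (hg a b).2 h) ?_
    (hK.prod I _ fun θ => θ.2.1)
  intro x y hxy
  obtain ⟨a, rfl⟩ := A.proj_surjective _ x
  obtain ⟨b, rfl⟩ := A.proj_surjective _ y
  exact (A.proj_eq_iff _).2 ((hg a b).1 hxy)

/-- A homomorphism from `A` to a member of `K` that identifies the pairs in `X` identifies the
pairs in `Cg K A X`. -/
theorem eq_of_Cg {L : FirstOrder.Language.{u, v}} [L.IsAlgebraic] {K : ObjectProperty (Alg L)}
    (hK : IsQuasivariety K) {A B : Alg L} (hB : K B) (X : Set (A × A)) (f : A →[L] B)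
    (hf : ∀ p ∈ X, f p.1 = f p.2) (a b : A) (h : (Cg K A X).toSetoid a b) : f a = f b := by
  let θ : Congr A :=
    { toSetoid := Setoid.ker f
      compat := fun g x y hxy => by
        change f _ = f _
        rw [FirstOrder.Language.Hom.map_fun, FirstOrder.Language.Hom.map_fun]
        exact congrArg _ (funext fun i => hxy i) }
  refine h θ (hK.of_injective (Alg.quotLift θ f fun _ _ h => h) ?_ hB) hf
  intro x y hxy
  obtain ⟨a, rfl⟩ := A.proj_surjective _ x
  obtain ⟨b, rfl⟩ := A.proj_surjective _ y
  exact (A.proj_eq_iff θ).2 hxy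

/-- The algebra of terms of `L` with variables in the nonempty set `X`. -/
def termAlg (L : FirstOrder.Language.{u, v}) [L.IsAlgebraic] (X : Type u) [Nonempty X] :
    Alg L where
  carrier := L.Term X
  str := { funMap := fun f x => Term.func f x, RelMap := fun r => isEmptyElim r }
  ne := ⟨Term.var (Classical.arbitrary X)⟩

/-- The homomorphism from the term algebra that evaluates terms under `a : X → B`. -/
def evalHom {L : FirstOrder.Language.{u, v}} [L.IsAlgebraic] {X : Type u} [Nonempty X] {B : Alg L}
    (a : X → B) : termAlg L X →[L] B where
  toFun t := Term.realize a t
  map_fun' _ _ := rfl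
  map_rel' r := isEmptyElim r

/-- The free algebra `T_K(X)`. -/
noncomputable def freeAlg {L : FirstOrder.Language.{u, v}} [L.IsAlgebraic] (K : ObjectProperty (Alg L))
    (X : Type u) [Nonempty X] : Alg L :=
  (termAlg L X).quot (Cg K (termAlg L X) ∅)

/-- The element of `T_K(X)` represented by a term. -/
noncomputable def termClass {L : FirstOrder.Language.{u, v}} [L.IsAlgebraic] (K : ObjectProperty (Alg L))
    {X : Type u} [Nonempty X] : termAlg L X →[L] freeAlg K X :=
  (termAlg L X).proj _

/-- The positive diagram of an `L`-algebra `A`, as a set of pairs of elements of `T_M(A)`. -/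
def diag {L : FirstOrder.Language.{u, v}} {L' : FirstOrder.Language.{u, v'}} [L'.IsAlgebraic] (ι : L →ᴸ L')
    (M : ObjectProperty (Alg L')) (A : Alg L) :
    Set (freeAlg M A × freeAlg M A) :=
  { p | ∃ t s : L.Term A, t.realize id = s.realize id ∧
    p = (termClass M (ι.onTerm t), termClass M (ι.onTerm s)) }

/-- The free extension `F(A) = T_M(A) / θ_A` of an `L`-algebra `A`, where `θ_A` is the least
`M`-congruence that contains the positive diagram of `A`. -/
noncomputable def freeExtObj {L : FirstOrder.Language.{u, v}} {L' : FirstOrder.Language.{u, v'}} [L'.IsAlgebraic]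
    (ι : L →ᴸ L') (M : ObjectProperty (Alg L')) (A : Alg L) : Alg L' :=
  (freeAlg M A).quot (Cg M (freeAlg M A) (diag ι M A))

/-- The element `t / θ_A` of `F(A)`, for a term `t` of `L'` with variables in `A`. -/
noncomputable def extClass {L : FirstOrder.Language.{u, v}} {L' : FirstOrder.Language.{u, v'}} [L'.IsAlgebraic]
    (ι : L →ᴸ L') (M : ObjectProperty (Alg L')) (A : Alg L) :
    termAlg L' A →[L'] freeExtObj ι M A :=
  ((freeAlg M A).proj _).comp (termClass M)

theorem extClass_surjective {L : FirstOrder.Language.{u, v}} {L' : FirstOrder.Language.{u, v'}} [L'.IsAlgebraic]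
    (ι : L →ᴸ L') (M : ObjectProperty (Alg L')) (A : Alg L) :
    Function.Surjective (extClass ι M A) :=
  (Alg.proj_surjective _ _).comp (Alg.proj_surjective _ _)

theorem freeExtObj_mem {L : FirstOrder.Language.{u, v}} {L' : FirstOrder.Language.{u, v'}} [L'.IsAlgebraic]
    (ι : L →ᴸ L') {M : ObjectProperty (Alg L')} (hM : IsQuasivariety M) (A : Alg L) :
    M (freeExtObj ι M A) := quot_Cg_mem hM _ _

/-- The map `a ↦ a / θ_A`, a homomorphism from `A` to the reduct of `F(A)`. -/
noncomputable def unitHom {L : FirstOrder.Language.{u, v}} {L' : FirstOrder.Language.{u, v'}} [L.IsAlgebraic]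
    [L'.IsAlgebraic] (ι : L →ᴸ L') (M : ObjectProperty (Alg L')) (A : Alg L) :
    A →[L] (freeExtObj ι M A).reduct ι where
  toFun a := extClass ι M A (Term.var a)
  map_fun' {n} f x := by
    have key : extClass ι M A (ι.onTerm (Term.var (Structure.funMap f x))) =
        extClass ι M A (ι.onTerm (Term.func f fun i => Term.var (x i))) :=
      (Alg.proj_eq_iff _ _).2 (Cg_subset _ _ _ (_, _)
        ⟨Term.var (Structure.funMap f x), Term.func f fun i => Term.var (x i), rfl, rfl⟩)
    exact key.trans (FirstOrder.Language.Hom.map_fun (extClass ι M A) (ι.onFunction f)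
      fun i => Term.var (x i))
  map_rel' r := isEmptyElim r

theorem realize_reduct {L : FirstOrder.Language.{u, v}} {L' : FirstOrder.Language.{u, v'}} [L.IsAlgebraic]
    (ι : L →ᴸ L') {A : Alg L} {B : Alg L'} (h : A →[L] B.reduct ι) (t : L.Term A) :
    Term.realize (L := L') (M := B) h (ι.onTerm t) = h (t.realize id) := by
  induction t with
  | var a => rfl
  | func f ts ih =>
    simp only [LHom.onTerm, Term.realize]
    rw [FirstOrder.Language.Hom.map_fun]
    exact congrArg (Structure.funMap (ι.onFunction f)) (funext fun i => ih i)

/-- The extension of a homomorphism `h : A → U(B)` to a homomorphism `F(A) → B`, given by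
`t(a₁, …, aₙ) / θ_A ↦ t(h a₁, …, h aₙ)`. -/
noncomputable def extend {L : FirstOrder.Language.{u, v}} {L' : FirstOrder.Language.{u, v'}} [L.IsAlgebraic]
    [L'.IsAlgebraic] (ι : L →ᴸ L') {M : ObjectProperty (Alg L')} (hM : IsQuasivariety M)
    {A : Alg L} {B : Alg L'} (hB : M B) (h : A →[L] B.reduct ι) : freeExtObj ι M A →[L'] B :=
  Alg.quotLift _
    (Alg.quotLift _ (evalHom (B := B) h)
      (eq_of_Cg hM hB ∅ (evalHom (B := B) h) fun _ hp => hp.elim))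
    (eq_of_Cg hM hB _ _ (by
      rintro _ ⟨t, s, hts, rfl⟩
      change Term.realize (L := L') (M := B) h (ι.onTerm t) =
        Term.realize (L := L') (M := B) h (ι.onTerm s)
      rw [realize_reduct, realize_reduct, hts]))

theorem extend_extClass {L : FirstOrder.Language.{u, v}} {L' : FirstOrder.Language.{u, v'}} [L.IsAlgebraic]
    [L'.IsAlgebraic] (ι : L →ᴸ L') {M : ObjectProperty (Alg L')} (hM : IsQuasivariety M)
    {A : Alg L} {B : Alg L'} (hB : M B) (h : A →[L] B.reduct ι) (t : L'.Term A) :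
    extend ι hM hB h (extClass ι M A t) = Term.realize (L := L') (M := B) h t := rfl

/-- Homomorphisms `F(A) → B` correspond to homomorphisms `A → U(B)`. -/
noncomputable def extEquiv {L : FirstOrder.Language.{u, v}} {L' : FirstOrder.Language.{u, v'}} [L.IsAlgebraic]
    [L'.IsAlgebraic] (ι : L →ᴸ L') {K : ObjectProperty (Alg L)} {M : ObjectProperty (Alg L')}
    (hM : IsQuasivariety M) (hKM : IsExpansion ι K M)
    (A : K.FullSubcategory) (B : M.FullSubcategory) :
    ((⟨freeExtObj ι M A.obj, freeExtObj_mem ι hM A.obj⟩ : M.FullSubcategory) ⟶ B) ≃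
      (A ⟶ (forgetful ι hKM).obj B) where
  toFun g := ObjectProperty.homMk
    ((show A.obj ⟶ (freeExtObj ι M A.obj).reduct ι from unitHom ι M A.obj) ≫
      (reductFunctor ι).map g.hom)
  invFun h := ObjectProperty.homMk (extend ι hM B.property h.hom)
  left_inv g := by
    apply ObjectProperty.hom_ext
    apply FirstOrder.Language.Hom.ext
    intro x
    obtain ⟨t, rfl⟩ := extClass_surjective ι M A.obj x
    refine (extend_extClass ι hM B.property _ t).trans ?_
    induction t with
    | var a => rfl
    | func f ts ih =>
      refine (congrArg (Structure.funMap f) (funext fun i => ih i)).trans ?_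
      have h₁ := FirstOrder.Language.Hom.map_fun (Alg.asHom g.hom) f
        (extClass ι M A.obj ∘ ts)
      have h₂ := FirstOrder.Language.Hom.map_fun (extClass ι M A.obj) f ts
      exact h₁.symm.trans (congrArg (Alg.asHom g.hom) h₂.symm)
  right_inv h := by
    apply ObjectProperty.hom_ext
    apply FirstOrder.Language.Hom.ext
    intro a
    rfl

/-- The free extension functor `F : K ⥤ M`. On morphisms it is
`t(a₁, …, aₙ) / θ_A ↦ t(h a₁, …, h aₙ) / θ_B`, see `freeExt_map`. -/
noncomputable def freeExt {L : FirstOrder.Language.{u, v}} {L' : FirstOrder.Language.{u, v'}} [L.IsAlgebraic]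
    [L'.IsAlgebraic] (ι : L →ᴸ L') {K : ObjectProperty (Alg L)} {M : ObjectProperty (Alg L')}
    (hM : IsQuasivariety M) (hKM : IsExpansion ι K M) : K.FullSubcategory ⥤ M.FullSubcategory :=
  Adjunction.leftAdjointOfEquiv (G := forgetful ι hKM) (extEquiv ι hM hKM) fun _ _ _ _ _ => rfl

/-- The free-extension adjunction `F ⊣ U`. -/
noncomputable def freeExtAdj {L : FirstOrder.Language.{u, v}} {L' : FirstOrder.Language.{u, v'}} [L.IsAlgebraic]
    [L'.IsAlgebraic] (ι : L →ᴸ L') {K : ObjectProperty (Alg L)} {M : ObjectProperty (Alg L')}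
    (hM : IsQuasivariety M) (hKM : IsExpansion ι K M) :
    freeExt ι hM hKM ⊣ forgetful ι hKM :=
  Adjunction.adjunctionOfEquivLeft (extEquiv ι hM hKM) fun _ _ _ _ _ => rfl

theorem freeExt_map {L : FirstOrder.Language.{u, v}} {L' : FirstOrder.Language.{u, v'}} [L.IsAlgebraic]
    [L'.IsAlgebraic] (ι : L →ᴸ L') {K : ObjectProperty (Alg L)} {M : ObjectProperty (Alg L')}
    (hM : IsQuasivariety M) (hKM : IsExpansion ι K M) {A B : K.FullSubcategory} (h : A ⟶ B)
    (t : L'.Term A.obj) :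
    Alg.asHom ((freeExt ι hM hKM).map h).hom
      (extClass ι M A.obj t) =
      extClass ι M B.obj (t.relabel (Alg.asHom h.hom)) := by
  refine (extend_extClass ι hM (freeExtObj_mem ι hM B.obj) _ t).trans ?_
  induction t with
  | var a => rfl
  | func f ts ih =>
    refine (congrArg (Structure.funMap f) (funext fun i => ih i)).trans ?_
    exact (FirstOrder.Language.Hom.map_fun (extClass ι M B.obj) f _).symm

theorem freeExtAdj_unit {L : FirstOrder.Language.{u, v}} {L' : FirstOrder.Language.{u, v'}} [L.IsAlgebraic]
    [L'.IsAlgebraic] (ι : L →ᴸ L') {K : ObjectProperty (Alg L)} {M : ObjectProperty (Alg L')}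
    (hM : IsQuasivariety M) (hKM : IsExpansion ι K M) (A : K.FullSubcategory) :
    Alg.asHom ((freeExtAdj ι hM hKM).unit.app A).hom = unitHom ι M A.obj := by
  simp only [freeExtAdj, Adjunction.adjunctionOfEquivLeft, Adjunction.mkOfHomEquiv_unit_app]
  rfl

theorem freeExtAdj_counit {L : FirstOrder.Language.{u, v}} {L' : FirstOrder.Language.{u, v'}} [L.IsAlgebraic]
    [L'.IsAlgebraic] (ι : L →ᴸ L') {K : ObjectProperty (Alg L)} {M : ObjectProperty (Alg L')}
    (hM : IsQuasivariety M) (hKM : IsExpansion ι K M) (B : M.FullSubcategory)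
    (t : L'.Term B.obj) :
    Alg.asHom ((freeExtAdj ι hM hKM).counit.app B).hom
      (extClass ι M (B.obj.reduct ι) t) = Term.realize (L := L') (M := B.obj) id t := by
  simp only [freeExtAdj, Adjunction.adjunctionOfEquivLeft, Adjunction.mkOfHomEquiv_counit_app]
  rfl

/-! ## Implicit operations and pp expansions -/

/-- A primitive positive formula: `∃ z₁ … z_m` in front of a finite conjunction of equations. -/
def IsPP {L : FirstOrder.Language.{u, v}} {α : Type} (φ : L.Formula α) : Prop :=
  ∃ (m : ℕ) (E : List (L.Term (α ⊕ Fin m) × L.Term (α ⊕ Fin m))),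
    φ = ((E.map fun e => e.1.bdEqual e.2).foldr (· ⊓ ·) ⊤ : L.BoundedFormula α m).exs

/-- An `n`-ary operation of `K`: a partial `n`-ary function on each member of `K`, globally
preserved by the homomorphisms between members of `K`. The case `n = 0` (a partially defined
constant) is included. -/
structure Operation {L : FirstOrder.Language.{u, v}} (K : ObjectProperty (Alg L)) (n : ℕ) where
  fn : ∀ A : K.FullSubcategory, (Fin n → A.obj) →. A.obj
  preserved : ∀ (A B : K.FullSubcategory) (h : A.obj →[L] B.obj) (a : Fin n → A.obj) (b : A.obj),
    b ∈ fn A a → h b ∈ fn B (h ∘ a)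

/-- The formula `φ(x₁, …, xₙ, y)` defines the operation `f` of `K`. -/
def Operation.DefinedBy {L : FirstOrder.Language.{u, v}} {K : ObjectProperty (Alg L)} {n : ℕ}
    (f : Operation K n) (φ : L.Formula (Fin n ⊕ Unit)) : Prop :=
  ∀ (A : K.FullSubcategory) (a : Fin n → A.obj) (b : A.obj),
    φ.Realize (Sum.elim a fun _ => b) ↔ b ∈ f.fn A a

/-- `f` is extendable: for every `A ∈ K` and every tuple `a` of elements of `A` there is an
extension `B ∈ K` of `A` with `a` in the domain of `f` on `B`. -/
def Operation.Extendable {L : FirstOrder.Language.{u, v}} {K : ObjectProperty (Alg L)} {n : ℕ}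
    (f : Operation K n) : Prop :=
  ∀ (A : K.FullSubcategory) (a : Fin n → A.obj),
    ∃ (B : K.FullSubcategory) (i : A.obj ↪[L] B.obj), (f.fn B (i ∘ a)).Dom

/-- The `n`-ary members of `ext_pp(K)`: the extendable operations of `K` that are definable by a
pp formula. -/
def extPP {L : FirstOrder.Language.{u, v}} (K : ObjectProperty (Alg L)) (n : ℕ) : Set (Operation K n) :=
  { f | f.Extendable ∧ ∃ φ : L.Formula (Fin n ⊕ Unit), IsPP φ ∧ f.DefinedBy φ }

/-- The `n`-ary function symbols of `L'` that do not belong to `L`. -/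
def NewSymbol {L : FirstOrder.Language.{u, v}} {L' : FirstOrder.Language.{u, v'}} (ι : L →ᴸ L') (n : ℕ) : Type u :=
  { g : L'.Functions n // g ∉ Set.range fun f : L.Functions n => ι.onFunction f }

/-- A family of members of `ext_pp(K)` indexed by the symbols of `L'` that do not belong to `L`:
it makes `L'` the language that arises from `L` by adding a new symbol of the appropriate arity
for each member of the family. The same operation may occur several times in the family. -/
structure PPFamily {L : FirstOrder.Language.{u, v}} {L' : FirstOrder.Language.{u, v'}} (ι : L →ᴸ L')
    (K : ObjectProperty (Alg L)) where
  op : ∀ n, NewSymbol ι n → Operation K n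
  mem : ∀ n g, op n g ∈ extPP K n

/-- The class `K[L_F]` of the algebras `A[L_F]`, where `A` ranges over the members of `K` on
which all operations of the family `F` are total. That is, an `L'`-algebra `B` is in it when its
`L`-reduct `A` is in `K`, the operations of `F` are total on `A`, and each new symbol is
interpreted in `B` as the corresponding operation on `A`. -/
def PPFamily.adjoin {L : FirstOrder.Language.{u, v}} {L' : FirstOrder.Language.{u, v'}} {ι : L →ᴸ L'}
    {K : ObjectProperty (Alg L)} (F : PPFamily ι K) : ObjectProperty (Alg L') :=
  fun B => ∃ hB : K (B.reduct ι), ∀ (n : ℕ) (g : NewSymbol ι n) (a : Fin n → B),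
    ∃ h : ((F.op n g).fn ⟨B.reduct ι, hB⟩ a).Dom,
      (Structure.funMap g.1 a : B) = ((F.op n g).fn ⟨B.reduct ι, hB⟩ a).get h

/-- `M` is a pp expansion of `K`: the class of subalgebras of members of `K[L_F]`, for some
family `F` of members of `ext_pp(K)`. -/
def IsPPExpansion {L : FirstOrder.Language.{u, v}} {L' : FirstOrder.Language.{u, v'}} (ι : L →ᴸ L')
    (K : ObjectProperty (Alg L)) (M : ObjectProperty (Alg L')) : Prop :=
  ∃ F : PPFamily ι K, M = subalgebras F.adjoin

/-- `M` is a simple pp expansion of `K`: a pp expansion of the form `K[L_F]`. -/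
def IsSimplePPExpansion {L : FirstOrder.Language.{u, v}} {L' : FirstOrder.Language.{u, v'}} (ι : L →ᴸ L')
    (K : ObjectProperty (Alg L)) (M : ObjectProperty (Alg L')) : Prop :=
  IsPPExpansion ι K M ∧ ∃ F : PPFamily ι K, M = F.adjoin

/-! ## Mono-reflective subcategories and isomorphisms of categories -/

/-- The full subcategory given by `P` is mono-reflective: its inclusion has a left adjoint, and
the components of the unit are monomorphisms. -/
def IsMonoReflective {C : Type*} [Category* C] (P : ObjectProperty C) : Prop :=
  ∃ (R : C ⥤ P.FullSubcategory) (adj : R ⊣ P.ι), ∀ X : C, Mono (adj.unit.app X)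

/-- A functor is an isomorphism of categories when it has a strict two-sided inverse. -/
def IsIsoOfCategories {C D : Type*} [Category* C] [Category* D] (G : C ⥤ D) : Prop :=
  ∃ H : D ⥤ C, G ⋙ H = 𝟭 C ∧ H ⋙ G = 𝟭 D

/-- The objects of the direct image of a functor. -/
def objImage {C D : Type*} [Category* C] [Category* D] (G : C ⥤ D) : ObjectProperty D :=
  fun Y => ∃ X : C, G.obj X = Y

/-- A functor, with its codomain restricted to the full subcategory on the objects of its direct
image. When this is an isomorphism of categories, the functor is full, so that this full
subcategory is the direct image itself. -/
def toObjImage {C D : Type*} [Category* C] [Category* D] (G : C ⥤ D) :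
    C ⥤ (objImage G).FullSubcategory :=
  (objImage G).lift G fun X => ⟨X, rfl⟩

end PPExp

/-!
The forgetful functor `U` of an expansion is faithful, so the counit of `F ⊣ U` is an isomorphism
exactly when `U` is full, that is, when the homomorphisms between reducts of members of `M` preserve
all symbols of `L'`. Monomorphisms of a quasivariety are the injective homomorphisms, so the units
are monomorphisms exactly when every `A ∈ K` embeds into `U(F(A))`.

*Simple pp expansions satisfy this.* In `K[L_F]` the new symbols are interpreted by operations of
`K`, and operations are preserved by homomorphisms, whence `U` is full
(`PPFamily.forgetful_full`). The unit at `A ∈ K` is injective as soon as `A` embeds into some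
`B ∈ K` on which all operations of the family are total, since `B` then expands to a member of `M`.
By extendability and Łoś's theorem, a suitable ultraproduct extends `A` so that all operations are
defined at all tuples of `A` (`PPFamily.exists_extension_dom`); the union of an `ω`-chain of such
extensions is the required `B` (`PPFamily.exists_total_extension`).

*Conversely*, let `U` be full and the units injective, and let `g` be a symbol of `L'`. Fullness and
closure under ultraproducts yield a compactness principle: for maps from an algebra `T ∈ M` to
members of `M`, preservation of `g` at one tuple already follows from preservation of finitely many
values of symbols of `L` (`exists_preservesOn_imp`). When `T` is free and the tuple consists of free
generators, these finitely many equations amount to a pp formula that defines the graph of `g` in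
all members of `M` (`exists_isPP_iff_funMap`). As each `A ∈ K` embeds into `U(F(A))`, the formula is
functional on `K` and defines an extendable operation of `K` (`exists_mem_extPP`). An algebra of
`K[L_F]` embeds into the free extension of its reduct by the unit, so that `K[L_F] = M`
(`isSimplePPExpansion_of_full`).

The equivalence of the two categorical conditions is formal
(`isMonoReflective_and_isIsoOfCategories_iff`), except that `U` has to be injective on objects: if
two members of `M` have the same reduct, fullness makes the identity map a homomorphism between
them (`forgetful_obj_injective`).
-/

namespace PPExp

/-! ### Adjunctions and full subcategories -/

section Categories

variable {C D : Type*} [Category* C] [Category* D]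

/-- A fully faithful functor that is bijective on objects has a strict inverse. -/
theorem isIsoOfCategories_of_bijective (G : C ⥤ D) [G.Full] [G.Faithful]
    (hG : Function.Bijective G.obj) : IsIsoOfCategories G := by
  choose r hr using hG.2
  let H : D ⥤ C :=
    { obj := r
      map := fun {X Y} f => G.preimage (eqToHom (hr X) ≫ f ≫ eqToHom (hr Y).symm)
      map_id := fun X => G.map_injective (by simp)
      map_comp := fun f g => G.map_injective (by simp) }
  refine ⟨H, CategoryTheory.Functor.ext (fun X => hG.1 (hr _)) fun X Y f => G.map_injective ?_,
    CategoryTheory.Functor.ext hr fun X Y f => ?_⟩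
  · simp [H, eqToHom_map]
  · simp [H]

theorem IsIsoOfCategories.isEquivalence {G : C ⥤ D} (hG : IsIsoOfCategories G) :
    G.IsEquivalence := by
  obtain ⟨H, h₁, h₂⟩ := hG
  exact (CategoryTheory.Equivalence.mk G H (eqToIso h₁.symm) (eqToIso h₂)).isEquivalence_functor

instance (G : C ⥤ D) [G.Faithful] : (toObjImage G).Faithful :=
  Functor.Faithful.of_comp_iso ((objImage G).liftCompιIso G fun X => ⟨X, rfl⟩)

instance (G : C ⥤ D) [G.Full] : (toObjImage G).Full :=
  Functor.Full.of_comp_faithful_iso ((objImage G).liftCompιIso G fun X => ⟨X, rfl⟩)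

/-- For a right adjoint that is injective on objects as soon as it is full, having a
mono-reflective direct image to which it is isomorphic amounts to a condition on the unit and
the counit. -/
theorem isMonoReflective_and_isIsoOfCategories_iff {F : C ⥤ D} {U : D ⥤ C} (adj : F ⊣ U)
    (hU : U.Full → Function.Injective U.obj) :
    (IsMonoReflective (objImage U) ∧ IsIsoOfCategories (toObjImage U)) ↔
      (∀ A : C, Mono (adj.unit.app A)) ∧ IsIso adj.counit := by
  constructor
  · rintro ⟨⟨R, adjR, hmono⟩, hiso⟩
    have := hiso.isEquivalence
    have : U.Full := inferInstanceAs (toObjImage U ⋙ (objImage U).ι).Full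
    have : U.Faithful := inferInstanceAs (toObjImage U ⋙ (objImage U).ι).Faithful
    refine ⟨fun A => ?_, inferInstance⟩
    -- The reflection of `A` is some `U X`, so its unit factors through that of `F ⊣ U`.
    obtain ⟨X, hX⟩ := (R.obj A).property
    have := hmono A
    let m : A ⟶ U.obj X := adjR.unit.app A ≫ eqToHom hX.symm
    have hm : adj.unit.app A ≫ U.map ((adj.homEquiv A X).symm m) = m :=
      (adj.homEquiv_apply _ _ _).symm.trans (Equiv.apply_symm_apply _ _)
    have : Mono (adj.unit.app A ≫ U.map ((adj.homEquiv A X).symm m)) := by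
      rw [hm]; exact mono_comp _ _
    exact mono_of_mono _ (U.map ((adj.homEquiv A X).symm m))
  · rintro ⟨hmono, _⟩
    have ff := adj.fullyFaithfulROfIsIsoCounit
    have := ff.full
    have := ff.faithful
    have hiso : IsIsoOfCategories (toObjImage U) := by
      refine isIsoOfCategories_of_bijective _ ⟨fun X Y h => hU ‹_› ?_, fun Y => ?_⟩
      · exact congrArg ObjectProperty.FullSubcategory.obj h
      · obtain ⟨X, hX⟩ := Y.property
        exact ⟨X, ObjectProperty.FullSubcategory.ext hX⟩
    refine ⟨?_, hiso⟩
    have := hiso.isEquivalence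
    let G := toObjImage U
    let e : G.inv ⋙ U ≅ (objImage U).ι :=
      Functor.isoWhiskerRight G.asEquivalence.counitIso (objImage U).ι
    let adjR : F ⋙ G ⊣ (objImage U).ι :=
      (adj.comp G.asEquivalence.toAdjunction).ofNatIsoRight e
    refine ⟨F ⋙ G, adjR, fun A => ?_⟩
    -- The unit of `F ⊣ U` factors through that of the reflection.
    let m : A ⟶ (objImage U).ι.obj (G.obj (F.obj A)) := adj.unit.app A
    have hm : adjR.unit.app A ≫ (objImage U).ι.map ((adjR.homEquiv A _).symm m) = m :=
      (adjR.homEquiv_apply _ _ _).symm.trans (Equiv.apply_symm_apply _ _)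
    have : Mono (adjR.unit.app A ≫ (objImage U).ι.map ((adjR.homEquiv A _).symm m)) := by
      rw [hm]; exact hmono A
    exact mono_of_mono _ ((objImage U).ι.map ((adjR.homEquiv A _).symm m))

end Categories

/-! ### Monomorphisms of quasivarieties -/

section Mono

variable {L : FirstOrder.Language.{u, v}} {K : ObjectProperty (Alg L)}

theorem mono_of_injective {A B : K.FullSubcategory} (f : A ⟶ B)
    (hf : Function.Injective (Alg.asHom f.hom)) : Mono f where
  right_cancellation g h hgh := by
    apply ObjectProperty.hom_ext
    apply FirstOrder.Language.Hom.ext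
    intro x
    exact hf (DFunLike.congr_fun (congrArg (fun k => Alg.asHom (InducedCategory.Hom.hom k)) hgh) x)

/-- The kernel of `f` is a subalgebra of `A × A`. Its two projections have the same composite with
`f`, so they are equal when `f` is a monomorphism. -/
theorem injective_of_mono [L.IsAlgebraic] (hK : IsQuasivariety K) {A B : K.FullSubcategory}
    (f : A ⟶ B) [Mono f] :
    Function.Injective (Alg.asHom f.hom) := by
  let φ := Alg.asHom f.hom
  let P : Alg L := Alg.pi fun _ : ULift.{u} Bool => A.obj
  let S : L.Substructure P :=
    { carrier := { x | φ (x ⟨true⟩) = φ (x ⟨false⟩) }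
      fun_mem := fun {n} g x hx => by
        change φ (Structure.funMap g fun j => x j ⟨true⟩) =
          φ (Structure.funMap g fun j => x j ⟨false⟩)
        rw [φ.map_fun, φ.map_fun]
        exact congrArg _ (funext fun j => hx j) }
  have hS : Nonempty S := ⟨⟨fun _ => Classical.arbitrary A.obj, rfl⟩⟩
  let E : K.FullSubcategory := ⟨P.sub S hS, hK.sub P S hS (hK.prod _ _ fun _ => A.property)⟩
  let p (b : Bool) : E.obj →[L] A.obj :=
    { toFun := fun x => x.1 ⟨b⟩
      map_fun' := fun g x => rfl
      map_rel' := fun r => isEmptyElim r }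
  have hp : (ObjectProperty.homMk (p true) : E ⟶ A) = ObjectProperty.homMk (p false) := by
    rw [← cancel_mono f]
    apply ObjectProperty.hom_ext
    apply FirstOrder.Language.Hom.ext
    intro x
    exact x.2
  intro a b hab
  let x : S := ⟨fun i => if i.down then a else b, hab⟩
  have := DFunLike.congr_fun (congrArg (fun k => Alg.asHom (InducedCategory.Hom.hom k)) hp) x
  exact this

end Mono

/-! ### The forgetful functor -/

section Forgetful

variable {L : FirstOrder.Language.{u, v}} {L' : FirstOrder.Language.{u, v'}}
  {ι : L →ᴸ L'} {K : ObjectProperty (Alg L)}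
  {M : ObjectProperty (Alg L')}

theorem map_funMap_of_newSymbol {B C : Alg L'} (h : B.reduct ι →[L] C.reduct ι)
    (hnew : ∀ (n : ℕ) (g : NewSymbol ι n) (a : Fin n → B),
      h (Structure.funMap g.1 a : B) = Structure.funMap (M := C) g.1 (h ∘ a))
    {n : ℕ} (g : L'.Functions n) (a : Fin n → B) :
    h (Structure.funMap g a : B) = Structure.funMap (M := C) g (h ∘ a) := by
  by_cases hg : g ∈ Set.range fun f : L.Functions n => ι.onFunction f
  · obtain ⟨f, rfl⟩ := hg
    exact h.map_fun f a
  · exact hnew n ⟨g, hg⟩ a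

variable [L.IsAlgebraic] (hKM : IsExpansion ι K M)

instance : (forgetful ι hKM).Faithful where
  map_injective {A B} f g h := by
    apply ObjectProperty.hom_ext
    apply FirstOrder.Language.Hom.ext
    intro x
    exact DFunLike.congr_fun (congrArg (fun k => Alg.asHom (InducedCategory.Hom.hom k)) h) x

/-- `U` is full when every homomorphism between reducts of members of `M` preserves the new
symbols. -/
theorem forgetful_full [L'.IsAlgebraic] (H : ∀ B C : Alg L', M B → M C →
      ∀ (h : B.reduct ι →[L] C.reduct ι) (n : ℕ) (g : NewSymbol ι n) (a : Fin n → B),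
      h (Structure.funMap g.1 a : B) = Structure.funMap (M := C) g.1 (h ∘ a)) :
    (forgetful ι hKM).Full where
  map_surjective {B C} f := by
    let h : B.obj.reduct ι →[L] C.obj.reduct ι := Alg.asHom f.hom
    let k : B.obj →[L'] C.obj :=
      { toFun := fun x => h x
        map_fun' := fun g a =>
          map_funMap_of_newSymbol h (H _ _ B.property C.property h) g a
        map_rel' := fun r => isEmptyElim r }
    exact ⟨ObjectProperty.homMk k, rfl⟩

theorem map_funMap_of_full [(forgetful ι hKM).Full] {B C : Alg L'} (hB : M B) (hC : M C)
    (h : B.reduct ι →[L] C.reduct ι) {n : ℕ} (g : L'.Functions n) (a : Fin n → B) :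
    h (Structure.funMap g a : B) = Structure.funMap (M := C) g (h ∘ a) := by
  let B' : M.FullSubcategory := ⟨B, hB⟩
  let C' : M.FullSubcategory := ⟨C, hC⟩
  let f : (forgetful ι hKM).obj B' ⟶ (forgetful ι hKM).obj C' := ObjectProperty.homMk h
  obtain ⟨k, hk⟩ := (forgetful ι hKM).map_surjective f
  have key : ∀ x : B, Alg.asHom k.hom x = h x := fun x =>
    DFunLike.congr_fun (congrArg (fun k => Alg.asHom (InducedCategory.Hom.hom k)) hk) x
  have := (Alg.asHom k.hom).map_fun g a
  rw [key] at this
  exact this.trans (congrArg _ (funext fun i => key _))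

/-- Algebras of `M` with the same reduct are equal when `U` is full, since the identity map is
then a homomorphism between them. -/
theorem forgetful_obj_injective [L'.IsAlgebraic] [(forgetful ι hKM).Full] :
    Function.Injective (forgetful ι hKM).obj := by
  rintro ⟨@⟨B, sB, nB⟩, hB⟩ ⟨@⟨C, sC, nC⟩, hC⟩ h
  have h' : @Alg.mk L B (@LHom.reduct L L' ι B sB) nB = @Alg.mk L C (@LHom.reduct L L' ι C sC) nC :=
    congrArg ObjectProperty.FullSubcategory.obj h
  injection h' with hBC hs
  subst hBC
  let B' : Alg L' := @Alg.mk L' B sB nB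
  let C' : Alg L' := @Alg.mk L' B sC nC
  have hs' : @LHom.reduct L L' ι B sB = @LHom.reduct L L' ι B sC := eq_of_heq hs
  let k : B'.reduct ι →[L] C'.reduct ι :=
    { toFun := id
      map_fun' := fun {n} f x =>
        congrArg (fun s : L.Structure B => s.funMap f x) hs'
      map_rel' := fun r => isEmptyElim r }
  have : sB = sC := by
    ext n g x
    · exact map_funMap_of_full hKM (B := B') (C := C') hB hC k g x
    · exact isEmptyElim g
  subst this
  rfl

end Forgetful

/-! ### Ultraproducts and unions of chains -/

section Ultraproducts

variable {L : FirstOrder.Language.{u, v}}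

/-- The element of an ultraproduct represented by a family of elements. -/
def Alg.ultraMk {I : Type u} (U : Ultrafilter I) {A : I → Alg L} (x : ∀ i, A i) :
    Alg.ultraprod U A :=
  Quotient.mk _ x

theorem Alg.ultraMk_eq_iff {I : Type u} {U : Ultrafilter I} {A : I → Alg L} {x y : ∀ i, A i} :
    Alg.ultraMk U x = Alg.ultraMk U y ↔ ∀ᶠ i in (U : Filter I), x i = y i :=
  Quotient.eq''

theorem Alg.funMap_ultraMk {I : Type u} (U : Ultrafilter I) {A : I → Alg L} {n : ℕ}
    (f : L.Functions n) (x : Fin n → ∀ i, A i) :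
    Structure.funMap f (fun j => Alg.ultraMk U (x j)) =
      Alg.ultraMk U fun i => Structure.funMap f fun j => x j i :=
  FirstOrder.Language.Ultraproduct.funMap_cast f x

theorem Alg.realize_ultraMk {I : Type u} (U : Ultrafilter I) {A : I → Alg L} {α : Type*}
    (φ : L.Formula α) (x : α → ∀ i, A i) :
    φ.Realize (fun j => Alg.ultraMk U (x j)) ↔
      ∀ᶠ i in (U : Filter I), φ.Realize fun j => x j i :=
  FirstOrder.Language.Ultraproduct.realize_formula_cast φ x

/-- An ultrafilter on the finite subsets of `D` that contains, for each `d`, the set of the finite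
subsets that `d` belongs to. -/
theorem exists_ultrafilter_finset (D : Type u) :
    ∃ U : Ultrafilter (Finset D), ∀ d, ∀ᶠ S in (U : Filter (Finset D)), d ∈ S := by
  classical
  refine ⟨Ultrafilter.of Filter.atTop, fun d => ?_⟩
  refine Filter.Eventually.filter_mono (Ultrafilter.of_le _) ?_
  filter_upwards [Filter.eventually_ge_atTop {d}] with S hS
  exact hS (Finset.mem_singleton_self d)

/-- Quasivarieties are closed under unions of chains of type `ω`: such a union embeds into an
ultraproduct of the members of the chain. -/
theorem IsQuasivariety.exists_chain_limit [L.IsAlgebraic] {K : ObjectProperty (Alg L)}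
    (hK : IsQuasivariety K) (A : ℕ → Alg L) (hA : ∀ n, K (A n)) (f : ∀ n, A n ↪[L] A (n + 1)) :
    ∃ (B : Alg L) (_ : K B) (j : ∀ n, A n ↪[L] B), (∀ n x, j (n + 1) (f n x) = j n x) ∧
      ∀ (k : ℕ) (b : Fin k → B), ∃ (n : ℕ) (a : Fin k → A n), b = j n ∘ a := by
  let F := FirstOrder.Language.DirectedSystem.natLERec (G' := fun n => A n) f
  let U : Ultrafilter (ULift.{u} ℕ) := (Filter.hyperfilter ℕ).map ULift.up
  have hU : ∀ n, ∀ᶠ m in (U : Filter (ULift.{u} ℕ)), n ≤ m.down := fun n =>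
    Nat.hyperfilter_le_atTop (Filter.eventually_ge_atTop n)
  let P : Alg L := Alg.ultraprod U fun m => A m.down
  -- An element `x` of `A n` is represented by its images in the `A m` with `n ≤ m`.
  let c (n : ℕ) (x : A n) (m : ULift.{u} ℕ) : A m.down :=
    if h : n ≤ m.down then F n m.down h x else Classical.arbitrary _
  have hc : ∀ {n : ℕ} {m : ULift.{u} ℕ} (h : n ≤ m.down) (x : A n), c n x m = F n m.down h x :=
    fun h x => dif_pos h
  let g₀ (n : ℕ) : A n →[L] P :=
    { toFun := fun x => Alg.ultraMk U (c n x)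
      map_fun' := fun {k} φ x => by
        refine Eq.trans ?_ (Alg.funMap_ultraMk U φ fun j => c n (x j)).symm
        refine Alg.ultraMk_eq_iff.2 ((hU n).mono fun m hm => ?_)
        simp only [hc hm]
        exact (F n m.down hm).map_fun φ x
      map_rel' := fun r => isEmptyElim r }
  have hg₀ : ∀ n, Function.Injective (g₀ n) := fun n x y hxy => by
    obtain ⟨m, hm, hxy⟩ := ((hU n).and (Alg.ultraMk_eq_iff.1 hxy)).exists
    rw [hc hm, hc hm] at hxy
    exact (F n m.down hm).injective hxy
  let g (n : ℕ) : A n ↪[L] P := FirstOrder.Language.Embedding.ofInjective (hg₀ n)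
  have hg : ∀ i j (hij : i ≤ j) x, g j (F i j hij x) = g i x := fun i j hij x => by
    refine Alg.ultraMk_eq_iff.2 ((hU j).mono fun m hm => ?_)
    rw [hc hm, hc (hij.trans hm)]
    exact DirectedSystem.map_map (f := fun i j h => F i j h) hij hm x
  let B : Alg L := 
    { carrier := FirstOrder.Language.DirectLimit (fun n => A n) F
      ne := ⟨FirstOrder.Language.DirectLimit.of L ℕ (fun n => A n) F 0 (Classical.arbitrary _)⟩ }
  have hB : K B := hK.of_injective
    (FirstOrder.Language.DirectLimit.lift L ℕ (fun n => A n) F g hg).toHom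
    (FirstOrder.Language.DirectLimit.lift L ℕ (fun n => A n) F g hg).injective
    (hK.ultraprod _ U _ fun m => hA m.down)
  refine ⟨B, hB, fun n => FirstOrder.Language.DirectLimit.of L ℕ (fun n => A n) F n,
    fun n x => ?_, fun k b => ?_⟩
  · -- The connecting maps of the limit iterate the maps `f n`.
    have : F n (n + 1) n.le_succ x = f n x := by
      simp only [F, FirstOrder.Language.DirectedSystem.coe_natLERec]
      exact Nat.leRecOn_succ' (C := fun n => A n) (next := fun {k} => f k) x
    rw [← this]
    exact FirstOrder.Language.DirectLimit.of_f
  · exact FirstOrder.Language.DirectLimit.exists_quotient_mk'_sigma_mk'_eq _ _ b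

end Ultraproducts

/-! ### Extensions on which all operations of a family are total -/

section Total

variable {L : FirstOrder.Language.{u, v}} {L' : FirstOrder.Language.{u, v'}} {ι : L →ᴸ L'}
  {K : ObjectProperty (Alg L)}

theorem Operation.dom_map {n : ℕ} (f : Operation K n) {A B : K.FullSubcategory}
    (h : A.obj →[L] B.obj) {a : Fin n → A.obj} (ha : (f.fn A a).Dom) : (f.fn B (h ∘ a)).Dom :=
  Part.dom_iff_mem.2 ⟨_, f.preserved A B h a _ (Part.get_mem ha)⟩

theorem PPFamily.exists_extension_finset (F : PPFamily ι K) (A : K.FullSubcategory)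
    (S : Finset (Σ n, NewSymbol ι n × (Fin n → A.obj))) :
    ∃ (B : K.FullSubcategory) (i : A.obj ↪[L] B.obj),
      ∀ p ∈ S, ((F.op p.1 p.2.1).fn B (i ∘ p.2.2)).Dom := by
  classical
  induction S using Finset.induction_on with
  | empty => exact ⟨A, FirstOrder.Language.Embedding.refl L A.obj, by simp⟩
  | insert p S _ ih =>
    obtain ⟨B, i, hB⟩ := ih
    obtain ⟨C, j, hC⟩ := (F.mem p.1 p.2.1).1 B (i ∘ p.2.2)
    refine ⟨C, j.comp i, fun q hq => ?_⟩
    rcases Finset.mem_insert.1 hq with rfl | hq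
    · exact hC
    · exact (F.op q.1 q.2.1).dom_map j.toHom (hB q hq)

/-- Every `A ∈ K` has an extension in `K` in which all operations of the family are defined at all
tuples of elements of `A`: an ultraproduct of extensions that deal with finitely many tuples. It is
here that definability of the operations by formulas is needed, for Łoś's theorem. -/
theorem PPFamily.exists_extension_dom [L.IsAlgebraic] (hK : IsQuasivariety K) (F : PPFamily ι K)
    (A : K.FullSubcategory) :
    ∃ (B : K.FullSubcategory) (i : A.obj ↪[L] B.obj), ∀ (n : ℕ) (g : NewSymbol ι n)
      (a : Fin n → A.obj), ((F.op n g).fn B (i ∘ a)).Dom := by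
  classical
  let D := Σ n, NewSymbol ι n × (Fin n → A.obj)
  choose B i hB using F.exists_extension_finset A
  obtain ⟨U, hU⟩ := exists_ultrafilter_finset D
  let P : K.FullSubcategory :=
    ⟨Alg.ultraprod U fun S => (B S).obj, hK.ultraprod _ U _ fun S => (B S).property⟩
  let j₀ : A.obj →[L] P.obj :=
    { toFun := fun a => Alg.ultraMk U fun S => i S a
      map_fun' := fun {k} φ x => by
        refine Eq.trans ?_ (Alg.funMap_ultraMk U φ fun l S => i S (x l)).symm
        exact congrArg (Alg.ultraMk U) (funext fun S => (i S).map_fun φ x)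
      map_rel' := fun r => isEmptyElim r }
  have hj₀ : Function.Injective j₀ := fun a b hab => by
    obtain ⟨S, hS⟩ := (Alg.ultraMk_eq_iff.1 hab).exists
    exact (i S).injective hS
  refine ⟨P, FirstOrder.Language.Embedding.ofInjective hj₀, fun n g a => ?_⟩
  obtain ⟨φ, -, hφ⟩ := (F.mem n g).2
  let y (S : Finset D) : (B S).obj :=
    if h : ((F.op n g).fn (B S) (i S ∘ a)).Dom then Part.get _ h else Classical.arbitrary _
  let x : Fin n ⊕ Unit → ∀ S, (B S).obj := Sum.elim (fun k S => i S (a k)) fun _ => y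
  have hx : φ.Realize fun k => Alg.ultraMk U (x k) := by
    refine (Alg.realize_ultraMk U φ x).2 ((hU ⟨n, g, a⟩).mono fun S hS => ?_)
    have hdom : ((F.op n g).fn (B S) (i S ∘ a)).Dom := hB S _ hS
    have hy : y S = Part.get _ hdom := dif_pos hdom
    have := (hφ (B S) (i S ∘ a) (y S)).2 (hy ▸ Part.get_mem hdom)
    convert! this using 1
    funext k
    rcases k with k | k <;> rfl
  refine Part.dom_iff_mem.2 ⟨Alg.ultraMk U y, (hφ P (j₀ ∘ a) _).1 ?_⟩
  convert! hx using 1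
  funext k
  rcases k with k | k <;> rfl

/-- Every `A ∈ K` embeds into a member of `K` on which all operations of the family are total. -/
theorem PPFamily.exists_total_extension [L.IsAlgebraic] (hK : IsQuasivariety K) (F : PPFamily ι K)
    (A : K.FullSubcategory) :
    ∃ (B : K.FullSubcategory) (_ : A.obj ↪[L] B.obj), ∀ (n : ℕ) (g : NewSymbol ι n)
      (b : Fin n → B.obj), ((F.op n g).fn B b).Dom := by
  choose N e he using F.exists_extension_dom hK
  let C : ℕ → K.FullSubcategory := Nat.rec A fun _ B => N B
  obtain ⟨B, hB, j, hj, hfin⟩ := hK.exists_chain_limit (fun n => (C n).obj)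
    (fun n => (C n).property) fun n => e (C n)
  refine ⟨⟨B, hB⟩, j 0, fun k g b => ?_⟩
  obtain ⟨n, a, rfl⟩ := hfin k b
  have := (F.op k g).dom_map (A := C (n + 1)) (B := ⟨B, hB⟩) (j (n + 1)).toHom (he (C n) k g a)
  have heq : j n ∘ a = (j (n + 1)).toHom ∘ (e (C n) ∘ a) := funext fun l => (hj n (a l)).symm
  rwa [heq]

open Classical in
/-- The expansion `A[L_F]` of a member `A` of `K` on which all operations of `F` are total. A symbol
in the range of `ι` is interpreted through a chosen preimage, the only one when `ι` is injective. -/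
noncomputable def PPFamily.expand [L'.IsAlgebraic] (F : PPFamily ι K) (A : K.FullSubcategory)
    (hA : ∀ (n : ℕ) (g : NewSymbol ι n) (a : Fin n → A.obj), ((F.op n g).fn A a).Dom) :
    Alg L' where
  carrier := A.obj
  str :=
    { funMap := fun {n} g a =>
        if h : g ∈ Set.range fun f : L.Functions n => ι.onFunction f then
          Structure.funMap h.choose a
        else ((F.op n ⟨g, h⟩).fn A a).get (hA n ⟨g, h⟩ a)
      RelMap := fun r => isEmptyElim r }

/-- The reduct of `A[L_F]` is `A`. -/
def PPFamily.expandEquiv [L.IsAlgebraic] [L'.IsAlgebraic] (hι : ι.Injective) (F : PPFamily ι K)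
    (A : K.FullSubcategory)
    (hA : ∀ (n : ℕ) (g : NewSymbol ι n) (a : Fin n → A.obj), ((F.op n g).fn A a).Dom) :
    A.obj ≃[L] (F.expand A hA).reduct ι where
  toEquiv := Equiv.refl _
  map_fun' {n} f a := by
    have h : ι.onFunction f ∈ Set.range fun f : L.Functions n => ι.onFunction f := ⟨f, rfl⟩
    have hf : h.choose = f := hι.onFunction h.choose_spec
    refine Eq.symm ((dif_pos h).trans ?_)
    rw [hf]
    rfl
  map_rel' r := isEmptyElim r

theorem PPFamily.expand_mem_adjoin [L.IsAlgebraic] [L'.IsAlgebraic] (hK : IsQuasivariety K)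
    (hι : ι.Injective) (F : PPFamily ι K) (A : K.FullSubcategory)
    (hA : ∀ (n : ℕ) (g : NewSymbol ι n) (a : Fin n → A.obj), ((F.op n g).fn A a).Dom) :
    F.adjoin (F.expand A hA) := by
  have hB : K ((F.expand A hA).reduct ι) := hK.iso _ _ ⟨F.expandEquiv hι A hA⟩ A.property
  refine ⟨hB, fun n g a => ?_⟩
  have hmem := (F.op n g).preserved A ⟨_, hB⟩ (F.expandEquiv hι A hA).toHom a _
    (Part.get_mem (hA n g a))
  refine ⟨Part.dom_iff_mem.2 ⟨_, hmem⟩, ?_⟩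
  refine Eq.trans ?_ (Part.get_eq_of_mem hmem _).symm
  exact dif_neg g.2

end Total

/-! ### Simple pp expansions have a fully faithful forgetful functor -/

section Forward

variable {L : FirstOrder.Language.{u, v}} {L' : FirstOrder.Language.{u, v'}}
  [L.IsAlgebraic] [L'.IsAlgebraic] {ι : L →ᴸ L'} {K : ObjectProperty (Alg L)}

theorem PPFamily.forgetful_full (F : PPFamily ι K) (hKM : IsExpansion ι K F.adjoin) :
    (forgetful ι hKM).Full := by
  refine PPExp.forgetful_full hKM fun B C hB hC h n g a => ?_
  obtain ⟨hB', hB⟩ := hB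
  obtain ⟨hC', hC⟩ := hC
  obtain ⟨hd, hg⟩ := hB n g a
  obtain ⟨hd', hg'⟩ := hC n g (h ∘ a)
  rw [hg, hg']
  exact (Part.get_eq_of_mem
    ((F.op n g).preserved ⟨_, hB'⟩ ⟨_, hC'⟩ h a _ (Part.get_mem hd)) hd').symm

/-- A homomorphism from `A` to the reduct of a member of `M` factors through the unit. -/
theorem unitHom_injective {M : ObjectProperty (Alg L')} (hM : IsQuasivariety M) {A : Alg L}
    {B : Alg L'} (hB : M B) (h : A →[L] B.reduct ι) (hh : Function.Injective h) :
    Function.Injective (unitHom ι M A) := fun x y hxy => by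
  have := congrArg (extend ι hM hB h) hxy
  exact hh this

theorem PPFamily.unitHom_injective (hK : IsQuasivariety K) (hι : ι.Injective) (F : PPFamily ι K)
    (hM : IsQuasivariety F.adjoin) (A : K.FullSubcategory) :
    Function.Injective (unitHom ι F.adjoin A.obj) := by
  obtain ⟨B, i, hB⟩ := F.exists_total_extension hK A
  refine PPExp.unitHom_injective hM (F.expand_mem_adjoin hK hι B hB)
    ((F.expandEquiv hι B hB).toHom.comp i.toHom) ?_
  exact (F.expandEquiv hι B hB).injective.comp i.injective

end Forward

/-! ### Primitive positive formulas -/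

section PP

variable {L : FirstOrder.Language.{u, v}}

theorem realize_exs_foldr {α : Type} {m : ℕ}
    (E : List (L.Term (α ⊕ Fin m) × L.Term (α ⊕ Fin m))) (A : Alg L) (w : α → A) :
    FirstOrder.Language.Formula.Realize
      ((E.map fun e => e.1.bdEqual e.2).foldr (· ⊓ ·) ⊤ : L.BoundedFormula α m).exs w ↔
    ∃ z : Fin m → A, ∀ e ∈ E, e.1.realize (Sum.elim w z) = e.2.realize (Sum.elim w z) := by
  rw [FirstOrder.Language.BoundedFormula.realize_exs]
  simp only [FirstOrder.Language.BoundedFormula.realize_foldr_inf, List.forall_mem_map,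
    FirstOrder.Language.BoundedFormula.realize_bdEqual]

theorem IsPP.realize_map {α : Type} {φ : L.Formula α} (hφ : IsPP φ) {A B : Alg L} (h : A →[L] B)
    {w : α → A} (hw : φ.Realize w) : φ.Realize (h ∘ w) := by
  obtain ⟨m, E, rfl⟩ := hφ
  obtain ⟨z, hz⟩ := (realize_exs_foldr E A w).1 hw
  refine (realize_exs_foldr E B (h ∘ w)).2 ⟨h ∘ z, fun e he => ?_⟩
  rw [← Sum.comp_elim, FirstOrder.Language.HomClass.realize_term,
    FirstOrder.Language.HomClass.realize_term, hz e he]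

/-- The map `h` from `T` to `A` preserves the operations of `T` at the finitely many arguments
listed in `S`. -/
def PreservesOn {T A : Alg L} (S : Finset (Σ k, L.Functions k × (Fin k → T))) (h : T → A) : Prop :=
  ∀ p ∈ S, h (Structure.funMap p.2.1 p.2.2) = Structure.funMap p.2.1 (h ∘ p.2.2)

/-- The existence of a map that extends the assignment `x ↦ a`, `y ↦ b` and preserves the
operations at finitely many given arguments is expressed by a pp formula, which existentially
quantifies over the values of the map at the finitely many elements that matter. -/
theorem exists_isPP_iff_preservesOn {T : Alg L} (S : Finset (Σ k, L.Functions k × (Fin k → T)))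
    {n : ℕ} (x : Fin n → T) (y : T) :
    ∃ φ : L.Formula (Fin n ⊕ Unit), IsPP φ ∧ ∀ (A : Alg L) (a : Fin n → A) (b : A),
      φ.Realize (Sum.elim a fun _ => b) ↔
        ∃ h : T → A, PreservesOn S h ∧ (∀ i, h (x i) = a i) ∧ h y = b := by
  classical
  let V : Finset T := insert y (Finset.univ.image x ∪
    S.biUnion fun p => insert (Structure.funMap p.2.1 p.2.2) (Finset.univ.image p.2.2))
  have hy : y ∈ V := Finset.mem_insert_self _ _
  have hx : ∀ i, x i ∈ V := fun i => Finset.mem_insert_of_mem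
    (Finset.mem_union_left _ (Finset.mem_image_of_mem _ (Finset.mem_univ i)))
  have hS : ∀ p ∈ S, Structure.funMap p.2.1 p.2.2 ∈ V := fun p hp => Finset.mem_insert_of_mem
    (Finset.mem_union_right _ (Finset.mem_biUnion.2 ⟨p, hp, Finset.mem_insert_self _ _⟩))
  have hS' : ∀ p ∈ S, ∀ j, p.2.2 j ∈ V := fun p hp j => Finset.mem_insert_of_mem
    (Finset.mem_union_right _ (Finset.mem_biUnion.2 ⟨p, hp, Finset.mem_insert_of_mem
      (Finset.mem_image_of_mem _ (Finset.mem_univ j))⟩))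
  let e : Fin V.card → T := fun i => (V.equivFin.symm i).1
  let idx : T → Fin V.card := fun t => V.equivFin (if ht : t ∈ V then ⟨t, ht⟩ else ⟨y, hy⟩)
  have he : ∀ t ∈ V, e (idx t) = t := fun t ht => by simp [e, idx, ht]
  let z (t : T) : L.Term ((Fin n ⊕ Unit) ⊕ Fin V.card) := Term.var (Sum.inr (idx t))
  let E : List (L.Term ((Fin n ⊕ Unit) ⊕ Fin V.card) × L.Term ((Fin n ⊕ Unit) ⊕ Fin V.card)) :=
    S.toList.map (fun p => (z (Structure.funMap p.2.1 p.2.2),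
      Term.func p.2.1 fun j => z (p.2.2 j))) ++
    (List.finRange n).map (fun i => (z (x i), Term.var (Sum.inl (Sum.inl i)))) ++
    [(z y, Term.var (Sum.inl (Sum.inr ())))]
  refine ⟨_, ⟨V.card, E, rfl⟩, fun A a b => (realize_exs_foldr E A _).trans ?_⟩
  have hE : ∀ c : Fin V.card → A,
      (∀ q ∈ E, q.1.realize (Sum.elim (Sum.elim a fun _ => b) c) =
        q.2.realize (Sum.elim (Sum.elim a fun _ => b) c)) ↔
      (∀ p ∈ S, c (idx (Structure.funMap p.2.1 p.2.2)) =
        Structure.funMap p.2.1 fun j => c (idx (p.2.2 j))) ∧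
      (∀ i, c (idx (x i)) = a i) ∧ c (idx y) = b := fun c => by
    simp only [E, z, List.forall_mem_append, List.forall_mem_map, Finset.mem_toList,
      List.mem_finRange, List.forall_mem_singleton, Term.realize, Sum.elim_inl, Sum.elim_inr,
      forall_true_left, and_assoc]
  constructor
  · rintro ⟨c, hc⟩
    obtain ⟨h₁, h₂, h₃⟩ := (hE c).1 hc
    exact ⟨c ∘ idx, h₁, h₂, h₃⟩
  · rintro ⟨h, h₁, h₂, h₃⟩
    refine ⟨h ∘ e, (hE _).2 ⟨fun p hp => ?_, fun i => ?_, ?_⟩⟩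
    · simp only [Function.comp_apply]
      rw [he _ (hS p hp), h₁ p hp]
      exact congrArg _ (funext fun j => congrArg h (he _ (hS' p hp j)).symm)
    · simp only [Function.comp_apply]
      rw [he _ (hx i), h₂ i]
    · simp only [Function.comp_apply]
      rw [he _ hy, h₃]

variable {K : ObjectProperty (Alg L)}

/-- The operation of `K` defined by a pp formula that is functional in the members of `K`. -/
noncomputable def Operation.ofPP {n : ℕ} (φ : L.Formula (Fin n ⊕ Unit)) (hφ : IsPP φ)
    (hfun : ∀ (A : K.FullSubcategory) (a : Fin n → A.obj) (b c : A.obj),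
      φ.Realize (Sum.elim a fun _ => b) → φ.Realize (Sum.elim a fun _ => c) → b = c) :
    Operation K n where
  fn A a := ⟨∃ b, φ.Realize (Sum.elim a fun _ => b), fun h => h.choose⟩
  preserved A B h a b := by
    rintro ⟨hb, rfl⟩
    have := hφ.realize_map h hb.choose_spec
    rw [Sum.comp_elim] at this
    have ex : ∃ c, φ.Realize (Sum.elim (h ∘ a) fun _ => c) := ⟨_, this⟩
    exact ⟨ex, hfun B _ _ _ ex.choose_spec this⟩

theorem Operation.ofPP_definedBy {n : ℕ} (φ : L.Formula (Fin n ⊕ Unit)) (hφ : IsPP φ)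
    (hfun : ∀ (A : K.FullSubcategory) (a : Fin n → A.obj) (b c : A.obj),
      φ.Realize (Sum.elim a fun _ => b) → φ.Realize (Sum.elim a fun _ => c) → b = c) :
    (Operation.ofPP φ hφ hfun).DefinedBy φ := fun A a b =>
  ⟨fun h =>
    have ex : ∃ c, φ.Realize (Sum.elim a fun _ => c) := ⟨b, h⟩
    ⟨ex, hfun A a _ _ ex.choose_spec h⟩, by
    rintro ⟨hb, rfl⟩
    exact hb.choose_spec⟩

end PP

/-! ### The operations induced by the new symbols -/

section Backward

variable {L : FirstOrder.Language.{u, v}} {L' : FirstOrder.Language.{u, v'}}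
  [L.IsAlgebraic] {ι : L →ᴸ L'} {K : ObjectProperty (Alg L)}
  {M : ObjectProperty (Alg L')}

/-- When `U` is full, preservation of a symbol `g` at a given argument `x` is already forced by
preservation of finitely many values of the symbols of `L`. Otherwise an ultraproduct of
counterexamples would be a homomorphism of reducts that does not preserve `g`. -/
theorem exists_preservesOn_imp (hM : IsQuasivariety M) (hKM : IsExpansion ι K M)
    [(forgetful ι hKM).Full] {T : Alg L'} (hT : M T) {n : ℕ} (g : L'.Functions n)
    (x : Fin n → T) :
    ∃ S : Finset (Σ k, L.Functions k × (Fin k → T.reduct ι)), ∀ B : Alg L', M B →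
      ∀ h : T → B, PreservesOn (T := T.reduct ι) (A := B.reduct ι) S h →
        h (Structure.funMap g x) = Structure.funMap g (h ∘ x) := by
  by_contra! H
  choose B hB h hS hne using H
  obtain ⟨U, hU⟩ := exists_ultrafilter_finset (Σ k, L.Functions k × (Fin k → T.reduct ι))
  let P : Alg L' := Alg.ultraprod U B
  let k : T.reduct ι →[L] P.reduct ι :=
    { toFun := fun t => Alg.ultraMk U fun S => h S t
      map_fun' := fun {m} f a => by
        refine Eq.trans ?_ (Alg.funMap_ultraMk U (ι.onFunction f) fun j S => h S (a j)).symm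
        exact Alg.ultraMk_eq_iff.2 ((hU ⟨m, f, a⟩).mono fun S hmem => hS S _ hmem)
      map_rel' := fun r => isEmptyElim r }
  have hk := (map_funMap_of_full hKM hT (hM.ultraprod _ U B hB) k g x).trans
    (Alg.funMap_ultraMk U g fun j S => h S (x j))
  obtain ⟨S, hS'⟩ := (Alg.ultraMk_eq_iff.1 hk).exists
  exact hne S hS'

/-- When `U` is full, the graph of each symbol `g` of `L'` is defined in the members of `M` by a
pp formula of `L`: apply `exists_preservesOn_imp` to free generators of a free algebra of `M`. -/
theorem exists_isPP_iff_funMap [L'.IsAlgebraic] (hM : IsQuasivariety M) (hKM : IsExpansion ι K M)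
    [(forgetful ι hKM).Full] {n : ℕ} (g : L'.Functions n) :
    ∃ φ : L.Formula (Fin n ⊕ Unit), IsPP φ ∧ ∀ B : Alg L', M B → ∀ (a : Fin n → B) (b : B),
      φ.Realize (M := B.reduct ι) (Sum.elim a fun _ => b) ↔ Structure.funMap g a = b := by
  -- The additional generator makes the set of generators nonempty for `n = 0`.
  let X := ULift.{u} (Option (Fin n))
  let T : Alg L' := freeAlg M X
  have hT : M T := quot_Cg_mem hM _ _
  let x : Fin n → T := fun i => termClass M (Term.var (⟨some i⟩ : X))
  obtain ⟨S, hS⟩ := exists_preservesOn_imp hM hKM hT g x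
  obtain ⟨φ, hφ, hφS⟩ :=
    exists_isPP_iff_preservesOn (T := T.reduct ι) S x (Structure.funMap g x : T)
  refine ⟨φ, hφ, fun B hB a b => (hφS (B.reduct ι) a b).trans ⟨?_, ?_⟩⟩
  · rintro ⟨h, h₁, h₂, rfl⟩
    refine Eq.trans ?_ (hS B hB h h₁).symm
    exact congrArg (Structure.funMap g) (funext fun i => (h₂ i).symm)
  · rintro rfl
    let v : X → B := fun o => o.down.elim (Classical.arbitrary B) a
    let h : T →[L'] B := Alg.quotLift _ (evalHom v)
      (eq_of_Cg hM hB ∅ (evalHom v) fun _ hp => hp.elim)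
    exact ⟨h, fun p _ => h.map_fun (ι.onFunction p.2.1) p.2.2, fun i => rfl, h.map_fun g x⟩

/-- When `U` is full and the units are injective, each symbol `g` of `L'` is interpreted in the
members of `M` by a member of `ext_pp(K)`. The formula that defines `g` in `M` is functional
in every `A ∈ K`, and defined somewhere above every tuple, because `A` embeds into `U(F(A))`. -/
theorem exists_mem_extPP [L'.IsAlgebraic] (hM : IsQuasivariety M) (hKM : IsExpansion ι K M)
    [(forgetful ι hKM).Full]
    (hunit : ∀ A : K.FullSubcategory, Function.Injective (unitHom ι M A.obj))
    {n : ℕ} (g : L'.Functions n) :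
    ∃ f ∈ extPP K n, ∀ (B : Alg L') (hB : M B) (a : Fin n → B) (b : B),
      b ∈ f.fn ⟨B.reduct ι, hKM B hB⟩ a ↔ Structure.funMap g a = b := by
  obtain ⟨φ, hφ, hφg⟩ := exists_isPP_iff_funMap hM hKM g
  have hF : ∀ A : K.FullSubcategory, M (freeExtObj ι M A.obj) := fun A => freeExtObj_mem ι hM A.obj
  have hmap : ∀ (A : K.FullSubcategory) (a : Fin n → A.obj) (b : A.obj),
      φ.Realize (Sum.elim a fun _ => b) →
        Structure.funMap (M := freeExtObj ι M A.obj) g (unitHom ι M A.obj ∘ a) =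
          unitHom ι M A.obj b := fun A a b h => by
    have := hφ.realize_map (unitHom ι M A.obj) h
    rw [Sum.comp_elim] at this
    exact (hφg _ (hF A) _ _).1 this
  have hfun : ∀ (A : K.FullSubcategory) (a : Fin n → A.obj) (b c : A.obj),
      φ.Realize (Sum.elim a fun _ => b) → φ.Realize (Sum.elim a fun _ => c) → b = c :=
    fun A a b c hb hc => hunit A ((hmap A a b hb).symm.trans (hmap A a c hc))
  have hdef := Operation.ofPP_definedBy φ hφ hfun
  refine ⟨Operation.ofPP φ hφ hfun, ⟨fun A a => ?_, φ, hφ, hdef⟩, fun B hB a b => ?_⟩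
  · exact ⟨⟨_, hKM _ (hF A)⟩, FirstOrder.Language.Embedding.ofInjective (hunit A),
      _, (hφg _ (hF A) _ _).2 rfl⟩
  · exact (hdef ⟨_, hKM B hB⟩ a b).symm.trans (hφg B hB a b)

/-- If `U` is full and the units are injective, then `M` is a simple pp expansion of `K`. An algebra
`B` of `K[L_F]` belongs to `M` because the unit embeds `B`, and not just its reduct `A`, into
`F(A)`. -/
theorem isSimplePPExpansion_of_full [L'.IsAlgebraic] (hM : IsQuasivariety M)
    (hKM : IsExpansion ι K M) [(forgetful ι hKM).Full]
    (hunit : ∀ A : K.FullSubcategory, Function.Injective (unitHom ι M A.obj)) :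
    IsSimplePPExpansion ι K M := by
  choose f hf hfM using fun n (g : NewSymbol ι n) => exists_mem_extPP hM hKM hunit g.1
  let F : PPFamily ι K := ⟨f, hf⟩
  have hMF : M = F.adjoin := by
    funext B
    refine propext ⟨fun hB => ⟨hKM B hB, fun n g a => ?_⟩, ?_⟩
    · have hmem := (hfM n g B hB a _).2 rfl
      exact ⟨Part.dom_iff_mem.2 ⟨_, hmem⟩, (Part.get_eq_of_mem hmem _).symm⟩
    · rintro ⟨hA, hB⟩
      let A : K.FullSubcategory := ⟨B.reduct ι, hA⟩
      let C : Alg L' := freeExtObj ι M A.obj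
      have hC : M C := freeExtObj_mem ι hM A.obj
      let k : B →[L'] C :=
        { toFun := fun b => unitHom ι M A.obj b
          map_fun' := map_funMap_of_newSymbol (B := B) (C := C) (unitHom ι M A.obj)
            fun n g a => by
              obtain ⟨hd, hg⟩ := hB n g a
              rw [hg]
              exact ((hfM n g C hC _ _).1 ((f n g).preserved A ⟨C.reduct ι, hKM C hC⟩
                (unitHom ι M A.obj) a _ (Part.get_mem hd))).symm
          map_rel' := fun r => isEmptyElim r }
      exact hM.of_injective k (hunit A) hC
  refine ⟨⟨F, ?_⟩, F, hMF⟩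
  rw [← hMF]
  funext B
  exact propext ⟨fun hB => ⟨B, hB, ⟨FirstOrder.Language.Embedding.refl L' B⟩⟩,
    fun ⟨C, hC, ⟨i⟩⟩ => hM.of_injective i.toHom i.injective hC⟩

end Backward

end PPExp

theorem mainTheorem1 {L : FirstOrder.Language.{u, v}} {L' : FirstOrder.Language.{u, v'}} [L.IsAlgebraic]
    [L'.IsAlgebraic] (ι : L →ᴸ L') (hι : ι.Injective)
    (K : ObjectProperty (PPExp.Alg L)) (M : ObjectProperty (PPExp.Alg L'))
    (hK : PPExp.IsQuasivariety K) (hM : PPExp.IsQuasivariety M)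
    (hKM : PPExp.IsExpansion ι K M) :
    List.TFAE [
      PPExp.IsSimplePPExpansion ι K M,
      (∀ A : K.FullSubcategory, Mono ((PPExp.freeExtAdj ι hM hKM).unit.app A)) ∧
        IsIso (PPExp.freeExtAdj ι hM hKM).counit,
      PPExp.IsMonoReflective (PPExp.objImage (PPExp.forgetful ι hKM)) ∧
        PPExp.IsIsoOfCategories (PPExp.toObjImage (PPExp.forgetful ι hKM))] := by
  tfae_have 1 → 2 := by
    rintro ⟨-, F, rfl⟩
    have := F.forgetful_full hKM
    refine ⟨fun A => PPExp.mono_of_injective _ ?_, inferInstance⟩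
    rw [PPExp.freeExtAdj_unit]
    exact F.unitHom_injective hK hι hM A
  tfae_have 2 → 1 := by
    rintro ⟨hmono, _⟩
    have := (PPExp.freeExtAdj ι hM hKM).fullyFaithfulROfIsIsoCounit.full
    refine PPExp.isSimplePPExpansion_of_full hM hKM fun A => ?_
    have := hmono A
    rw [← PPExp.freeExtAdj_unit ι hM hKM A]
    exact PPExp.injective_of_mono hK _
  tfae_have 3 ↔ 2 := PPExp.isMonoReflective_and_isIsoOfCategories_iff _ fun _ =>
    PPExp.forgetful_obj_injective hKM
  tfae_finish
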